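/- Let $U_1, U_2, \dots$ be independent random variables, each uniform on $[0,1]$, and put $$G_1 = 1-U_1,\quad G_2 = U_1(1-U_2),\quad G_3 = U_1U_2(1-U_3),\ \dots,\quad G_i = U_1\cdots U_{i-1}(1-U_i).$$ The Poisson--Dirichlet process with parameter $1$, written PD(1), is the sequence $X_1 \ge X_2 \ge \cdots$ obtained by sorting $G_1, G_2, \dots$ into non-increasing order. **Theorem (Kingman, 1977; Vershik and Schmidt, 1977).** For each $n$, let $l_1 \ge l_2 \ge \cdots$ be the cycle lengths (fixed points being cycles of length $1$) of a uniform random permutation of $n$ elements, and define $L_{jn} = l_j/n$, where the sequence of the $l_j$ is padded out with zeros. Then for each $k > 0$, as $n \to \infty$, the joint distribution of $(L_{1n}, \dots, L_{kn})$ converges weakly to the joint distribution of $(X_1, \dots, X_k)$, the first $k$ coordinates of PD(1). -/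

import Mathlib

/-- Permutations of `{0, …, n-1}` carry the discrete σ-algebra. -/
instance permMeasurableSpace (n : ℕ) : MeasurableSpace (Equiv.Perm (Fin n)) := ⊤

/-- `cycleLength σ j` is the length of the `(j+1)`-st longest cycle of `σ` (fixed points are
cycles of length one), and `0` if `σ` has at most `j` cycles. -/
def cycleLength {n : ℕ} (σ : Equiv.Perm (Fin n)) (j : ℕ) : ℕ :=
  (σ.partition.parts.sort (· ≥ ·)).getD j 0

/-- The stick-breaking sequence `1 - u₀, u₀ (1 - u₁), u₀ u₁ (1 - u₂), …` -/
def stickBreaking (u : ℕ → ℝ) (i : ℕ) : ℝ :=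
  (∏ m ∈ Finset.range i, u m) * (1 - u i)

/-- `sortDesc g j` is the `(j+1)`-st largest term of the sequence `g`, counted with multiplicity:
the largest `x` such that at least `j + 1` of the terms of `g` are `≥ x`. (The supremum is a maximum
when `g` is positive and tends to `0`, and `sortDesc g` is then the sequence of the terms of `g`
in non-increasing order.) -/
noncomputable def sortDesc (g : ℕ → ℝ) (j : ℕ) : ℝ :=
  sSup {x : ℝ | ∃ s : Finset ℕ, s.card = j + 1 ∧ ∀ i ∈ s, x ≤ g i}

/-- The Poisson–Dirichlet process (with parameter `1`) built from the process `U`, which is to be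
independent and uniform on `[0,1]`. -/
noncomputable def poissonDirichlet {Ω : Type*} (U : ℕ → Ω → ℝ) (j : ℕ) (ω : Ω) : ℝ :=
  sortDesc (stickBreaking (fun i => U i ω)) j

/-! The proof is a coupling. Cut a stick of integer length `n` by leaving a uniform remainder in
`{0, …, n-1}`, and repeat with the remainder. The multiset of pieces has the law of the cycle
lengths of a uniform permutation: both give `s` probability `1 / centralizerOrder s`
(`measure_discreteSticks_eq`, `measureReal_uniformOn_partition_parts_eq`).

All discrete sticks can be driven by the same uniforms `U i`. Piece `i` over `n` then differs from
`stickBreaking` by at most `(i + 1) / n`, while late pieces are all small because the products of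
the `U i` tend to `0` almost surely. So the convergence is uniform in `i`, and sorting is
1-Lipschitz in the sup norm (`abs_sortDesc_sub_le`). The sorted pieces thus converge almost surely,
hence in distribution, and equality of laws carries this over to permutations. -/

open MeasureTheory ProbabilityTheory Filter Topology

/-! ### Counting permutations by cycle type -/

/-- The order of the centralizer of a permutation with cycle lengths `s`. -/
def centralizerOrder (s : Multiset ℕ) : ℕ :=
  s.prod * ∏ c ∈ s.toFinset, (s.count c).factorial

lemma prod_factorial_count_of_subset {s : Multiset ℕ} {T : Finset ℕ} (h : s.toFinset ⊆ T) :
    ∏ c ∈ s.toFinset, (s.count c).factorial = ∏ c ∈ T, (s.count c).factorial := by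
  refine Finset.prod_subset h fun c _ hc => ?_
  rw [Multiset.mem_toFinset] at hc
  simp [Multiset.count_eq_zero_of_notMem hc]

lemma centralizerOrder_cons (c : ℕ) (s : Multiset ℕ) :
    centralizerOrder (c ::ₘ s) = c * (s.count c + 1) * centralizerOrder s := by
  have h1 : s.toFinset ⊆ insert c s.toFinset := Finset.subset_insert _ _
  have hc : c ∈ insert c s.toFinset := Finset.mem_insert_self _ _
  have h2 : ∏ x ∈ (insert c s.toFinset).erase c, ((c ::ₘ s).count x).factorial =
      ∏ x ∈ (insert c s.toFinset).erase c, (s.count x).factorial :=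
    Finset.prod_congr rfl fun x hx => by
      rw [Multiset.count_cons_of_ne (Finset.ne_of_mem_erase hx)]
  rw [centralizerOrder, centralizerOrder, prod_factorial_count_of_subset h1,
    Multiset.toFinset_cons, ← Finset.mul_prod_erase _ _ hc, ← Finset.mul_prod_erase _ _ hc, h2,
    Multiset.count_cons_self, Nat.factorial_succ, Multiset.prod_cons]
  ring

lemma centralizerOrder_pos {s : Multiset ℕ} (h : 0 ∉ s) : 0 < centralizerOrder s :=
  Nat.mul_pos (Nat.pos_of_ne_zero (by simpa [Multiset.prod_eq_zero_iff] using h))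
    (Finset.prod_pos fun _ _ => Nat.factorial_pos _)

lemma centralizerOrder_add_replicate_one {s : Multiset ℕ} (h : 1 ∉ s) (k : ℕ) :
    centralizerOrder (s + Multiset.replicate k 1) = k.factorial * centralizerOrder s := by
  induction k with
  | zero => simp
  | succ k ih =>
    rw [Multiset.replicate_succ, Multiset.add_cons, centralizerOrder_cons, ih, Multiset.count_add,
      Multiset.count_eq_zero_of_notMem h, Multiset.count_replicate_self, Nat.factorial_succ]
    ring

lemma filter_two_le_add_replicate_one {s : Multiset ℕ} (h : 0 ∉ s) :
    s.filter (2 ≤ ·) + Multiset.replicate (s.count 1) 1 = s := by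
  conv_rhs => rw [← Multiset.filter_add_not (2 ≤ ·) s]
  congr 1
  rw [← Multiset.filter_eq']
  refine Multiset.filter_congr fun x hx => ?_
  have : x ≠ 0 := fun h0 => h (h0 ▸ hx)
  omega

/-- `cycleType` omits fixed points, so `s` is split into its parts `≥ 2` and `k` ones; the ones
contribute the factor `k!`. -/
lemma card_perm_partition_parts_mul (n : ℕ) {s : Multiset ℕ} (h : 0 ∉ s) (hs : s.sum = n) :
    (Finset.univ.filter fun σ : Equiv.Perm (Fin n) => σ.partition.parts = s).card *
      centralizerOrder s = n.factorial := by
  set t := s.filter (2 ≤ ·) with ht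
  set k := s.count 1
  have hst : t + Multiset.replicate k 1 = s := filter_two_le_add_replicate_one h
  have hsum : t.sum + k = n := by
    rw [← hs, ← hst]; simp
  have h1 : 1 ∉ t := by simp [ht]
  have hiff : ∀ σ : Equiv.Perm (Fin n), σ.partition.parts = s ↔ σ.cycleType = t := by
    intro σ
    constructor
    · intro hσ
      rw [← σ.filter_parts_partition_eq_cycleType, hσ]
    · intro hσ
      rw [Equiv.Perm.parts_partition, ← Equiv.Perm.sum_cycleType, hσ, Fintype.card_fin, ← hst]
      congr 2
      omega
  have key := Equiv.Perm.card_of_cycleType_mul_eq (Fin n) t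
  rw [if_pos ⟨by rw [Fintype.card_fin]; omega, fun a ha => (Multiset.mem_filter.1 ha).2⟩,
    Fintype.card_fin, show n - t.sum = k by omega] at key
  simp only [hiff]
  rw [← key, ← hst, centralizerOrder_add_replicate_one h1, centralizerOrder]
  ring

/-- Removing `c` divides the order by `c * s.count c`, and these products add up to `s.sum`. This is
the recursion obtained by conditioning on the first piece. -/
lemma sum_inv_centralizerOrder_erase {s : Multiset ℕ} (h : 0 ∉ s) :
    ∑ c ∈ s.toFinset, ((centralizerOrder (s.erase c) : ℝ))⁻¹ =
      s.sum * (centralizerOrder s : ℝ)⁻¹ := by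
  rw [Finset.sum_multiset_count, Nat.cast_sum, Finset.sum_mul]
  refine Finset.sum_congr rfl fun c hc => ?_
  rw [Multiset.mem_toFinset] at hc
  have hc0 : c ≠ 0 := fun h0 => h (h0 ▸ hc)
  have hz : 0 < centralizerOrder (s.erase c) :=
    centralizerOrder_pos fun h0 => h (Multiset.mem_of_mem_erase h0)
  have e := centralizerOrder_cons c (s.erase c)
  have hcount := Multiset.count_cons_self c (s.erase c)
  rw [Multiset.cons_erase hc] at e hcount
  rw [← hcount] at e
  have hcp : 0 < s.count c := Multiset.count_pos.2 hc
  rw [e]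
  push_cast
  rw [smul_eq_mul]
  push_cast
  field_simp

/-! ### Discrete stick breaking and its distance to the continuous one -/

/-- The discrete uniform random variable on `{0, …, n}` built from a uniform `u` on `[0,1]`. -/
noncomputable def discreteRemainder (n : ℕ) (u : ℝ) : ℕ := min ⌊u * (n + 1)⌋₊ n

/-- Discrete stick breaking: a stick of length `n` is cut at integer points given by `u`. -/
noncomputable def discreteSticks : ℕ → (ℕ → ℝ) → List ℕ
  | 0, _ => []
  | n + 1, u => (n + 1 - discreteRemainder n (u 0)) ::
      discreteSticks (discreteRemainder n (u 0)) (fun i => u (i + 1))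
  termination_by n => n
  decreasing_by exact Nat.lt_succ_of_le (min_le_right _ _)

lemma discreteRemainder_le (n : ℕ) (u : ℝ) : discreteRemainder n u ≤ n := min_le_right _ _

lemma sum_discreteSticks (n : ℕ) (u : ℕ → ℝ) : (discreteSticks n u).sum = n := by
  induction n using Nat.strong_induction_on generalizing u with
  | _ n ih =>
    cases n with
    | zero => simp [discreteSticks]
    | succ n =>
      have := discreteRemainder_le n (u 0)
      rw [discreteSticks, List.sum_cons, ih _ (by omega)]
      omega

lemma zero_notMem_discreteSticks (n : ℕ) (u : ℕ → ℝ) : 0 ∉ discreteSticks n u := by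
  induction n using Nat.strong_induction_on generalizing u with
  | _ n ih =>
    cases n with
    | zero => simp [discreteSticks]
    | succ n =>
      have := discreteRemainder_le n (u 0)
      rw [discreteSticks, List.mem_cons, not_or]
      exact ⟨by omega, ih _ (by omega) _⟩

lemma discreteRemainder_cast_le (n : ℕ) {u : ℝ} (h : 0 ≤ u) :
    (discreteRemainder n u : ℝ) ≤ u * (n + 1) :=
  (Nat.cast_le.2 (min_le_left _ _)).trans (Nat.floor_le (by positivity))

lemma le_discreteRemainder_cast (n : ℕ) {u : ℝ} (h : u ≤ 1) :
    u * (n + 1) - 1 ≤ discreteRemainder n u := by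
  rw [discreteRemainder, Nat.cast_min, le_min_iff]
  exact ⟨(Nat.sub_one_lt_floor _).le, by nlinarith [(Nat.cast_nonneg n : (0 : ℝ) ≤ n)]⟩

lemma stickBreaking_succ (u : ℕ → ℝ) (i : ℕ) :
    stickBreaking u (i + 1) = u 0 * stickBreaking (fun i => u (i + 1)) i := by
  rw [stickBreaking, Finset.prod_range_succ', stickBreaking]; ring

lemma stickBreaking_nonneg {u : ℕ → ℝ} (hu : ∀ i, u i ∈ Set.Icc 0 1) (i : ℕ) :
    0 ≤ stickBreaking u i :=
  mul_nonneg (Finset.prod_nonneg fun m _ => (hu m).1) (sub_nonneg.2 (hu i).2)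

lemma stickBreaking_le_prod {u : ℕ → ℝ} (hu : ∀ i, u i ∈ Set.Icc 0 1) (i : ℕ) :
    stickBreaking u i ≤ ∏ m ∈ Finset.range i, u m :=
  mul_le_of_le_one_right (Finset.prod_nonneg fun m _ => (hu m).1) (by linarith [(hu i).1])

lemma prod_range_antitone {u : ℕ → ℝ} (hu : ∀ i, u i ∈ Set.Icc 0 1) :
    Antitone fun i => ∏ m ∈ Finset.range i, u m :=
  antitone_nat_of_succ_le fun i => by
    rw [Finset.prod_range_succ]
    exact mul_le_of_le_one_right (Finset.prod_nonneg fun m _ => (hu m).1) (hu i).2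

lemma stickBreaking_le_one {u : ℕ → ℝ} (hu : ∀ i, u i ∈ Set.Icc 0 1) (i : ℕ) :
    stickBreaking u i ≤ 1 :=
  (stickBreaking_le_prod hu i).trans (by simpa using prod_range_antitone hu (Nat.zero_le i))

/-- Rounding down never lengthens a remainder, so there is no additive error; this controls the
tail, where the bound `i + 1` below is useless. -/
lemma getD_discreteSticks_le (n : ℕ) {u : ℕ → ℝ} (hu : ∀ i, u i ∈ Set.Icc 0 1) (i : ℕ) :
    ((discreteSticks n u).getD i 0 : ℝ) ≤ n * ∏ m ∈ Finset.range i, u m := by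
  induction i generalizing n u with
  | zero =>
    cases n with
    | zero => simp [discreteSticks]
    | succ n =>
      rw [discreteSticks, List.getD_cons_zero, Finset.range_zero, Finset.prod_empty, mul_one]
      exact Nat.cast_le.2 (Nat.sub_le _ _)
  | succ i ih =>
    cases n with
    | zero => simp [discreteSticks]
    | succ n =>
      rw [discreteSticks, List.getD_cons_succ, Finset.prod_range_succ']
      refine (ih _ fun i => hu (i + 1)).trans ?_
      have := discreteRemainder_cast_le n (hu 0).1
      calc _ ≤ (u 0 * (n + 1)) * ∏ m ∈ Finset.range i, u (m + 1) :=
            mul_le_mul_of_nonneg_right this (Finset.prod_nonneg fun m _ => (hu (m + 1)).1)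
        _ = _ := by push_cast; ring

/-- Each cut rounds the remainder by at most `1`, and later factors in `[0,1]` do not amplify
earlier errors. -/
lemma abs_getD_discreteSticks_sub_le (n : ℕ) {u : ℕ → ℝ} (hu : ∀ i, u i ∈ Set.Icc 0 1) (i : ℕ) :
    |((discreteSticks n u).getD i 0 : ℝ) - n * stickBreaking u i| ≤ i + 1 := by
  induction i generalizing n u with
  | zero =>
    cases n with
    | zero => simp [discreteSticks]
    | succ n =>
      have h1 := discreteRemainder_cast_le n (hu 0).1
      have h2 := le_discreteRemainder_cast n (hu 0).2
      rw [discreteSticks, List.getD_cons_zero,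
        Nat.cast_sub ((discreteRemainder_le _ _).trans n.le_succ), abs_le, stickBreaking]
      push_cast
      constructor <;> simp <;> linarith
  | succ i ih =>
    cases n with
    | zero => simp [discreteSticks]; positivity
    | succ n =>
      have h1 := discreteRemainder_cast_le n (hu 0).1
      have h2 := le_discreteRemainder_cast n (hu 0).2
      have h3 := ih (discreteRemainder n (u 0)) fun i => hu (i + 1)
      have h4 := stickBreaking_nonneg (fun i => hu (i + 1)) i
      have h5 := stickBreaking_le_one (fun i => hu (i + 1)) i
      rw [discreteSticks, List.getD_cons_succ, stickBreaking_succ]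
      rw [abs_le] at h3 ⊢
      push_cast
      constructor <;> nlinarith

/-! ### Sorting sequences -/

lemma sortDesc_of_antitone {g : ℕ → ℝ} (hg : Antitone g) (j : ℕ) : sortDesc g j = g j := by
  refine IsGreatest.csSup_eq ⟨⟨Finset.range (j + 1), Finset.card_range _, fun i hi => hg ?_⟩, ?_⟩
  · exact Nat.le_of_lt_succ (Finset.mem_range.1 hi)
  · rintro x ⟨s, hs, hx⟩
    obtain ⟨i, hi, hij⟩ : ∃ i ∈ s, j ≤ i := by
      by_contra! hcon
      have : s ⊆ Finset.range j := fun i hi => Finset.mem_range.2 (hcon i hi)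
      have := Finset.card_le_card this
      rw [hs, Finset.card_range] at this
      omega
    exact (hx i hi).trans (hg hij)

lemma sortDesc_comp_equiv (g : ℕ → ℝ) (e : ℕ ≃ ℕ) (j : ℕ) :
    sortDesc (fun i => g (e i)) j = sortDesc g j := by
  unfold sortDesc
  congr 1
  ext x
  constructor
  · rintro ⟨s, hs, hx⟩
    refine ⟨s.map e.toEmbedding, by rw [Finset.card_map, hs], fun i hi => ?_⟩
    obtain ⟨a, ha, rfl⟩ := Finset.mem_map.1 hi
    exact hx a ha
  · rintro ⟨s, hs, hx⟩
    refine ⟨s.map e.symm.toEmbedding, by rw [Finset.card_map, hs], fun i hi => ?_⟩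
    obtain ⟨a, ha, rfl⟩ := Finset.mem_map.1 hi
    simpa using hx a ha

/-- Beyond the common length both lists read `d`, so the rearrangement extends to all of `ℕ`. -/
lemma List.Perm.exists_equiv_getD {α : Type*} {l l' : List α} (h : l.Perm l') (d : α) :
    ∃ e : ℕ ≃ ℕ, ∀ i, l.getD i d = l'.getD (e i) d := by
  induction h with
  | nil => exact ⟨Equiv.refl ℕ, fun _ => rfl⟩
  | cons a _ ih =>
    obtain ⟨e, he⟩ := ih
    refine ⟨⟨fun i => Nat.casesOn i 0 fun i => e i + 1,
      fun i => Nat.casesOn i 0 fun i => e.symm i + 1, ?_, ?_⟩, ?_⟩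
    · rintro (_ | i) <;> simp
    · rintro (_ | i) <;> simp
    · rintro (_ | i)
      · rfl
      · simpa using he i
  | swap a b l =>
    refine ⟨Equiv.swap 0 1, ?_⟩
    rintro (_ | _ | i)
    · simp
    · simp
    · rw [Equiv.swap_apply_of_ne_of_ne (by omega) (by omega)]
      simp
  | trans _ _ ih₁ ih₂ =>
    obtain ⟨e₁, h₁⟩ := ih₁
    obtain ⟨e₂, h₂⟩ := ih₂
    exact ⟨e₁.trans e₂, fun i => (h₁ i).trans (h₂ _)⟩

lemma List.Pairwise.antitone_getD_zero {l : List ℕ} (h : l.Pairwise (· ≥ ·)) :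
    Antitone fun i => l.getD i 0 := by
  intro i j hij
  rcases hij.eq_or_lt with rfl | hij
  · exact le_rfl
  by_cases hj : j < l.length
  · simpa [hj, hij.trans hj] using List.pairwise_iff_getElem.1 h i j (hij.trans hj) hj hij
  · simp only [List.getD_eq_default _ _ (not_lt.1 hj), Nat.zero_le]

lemma sortDesc_getD_div (l : List ℕ) (n j : ℕ) :
    sortDesc (fun i => (l.getD i 0 : ℝ) / n) j =
      (((l : Multiset ℕ).sort (· ≥ ·)).getD j 0 : ℝ) / n := by
  have hperm : l.Perm ((l : Multiset ℕ).sort (· ≥ ·)) :=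
    Multiset.coe_eq_coe.1 (Multiset.sort_eq _ _).symm
  obtain ⟨e, he⟩ := hperm.exists_equiv_getD 0
  simp only [he]
  rw [sortDesc_comp_equiv (fun i => (((l : Multiset ℕ).sort (· ≥ ·)).getD i 0 : ℝ) / n) e]
  refine sortDesc_of_antitone (fun a b hab => ?_) j
  have := (Multiset.pairwise_sort (l : Multiset ℕ) (· ≥ ·)).antitone_getD_zero hab
  gcongr

/-- The bounds on `h` and `g` keep the suprema away from the junk values of `sSup` on unbounded or
empty sets. -/
lemma sortDesc_le_add {g h : ℕ → ℝ} {ε C : ℝ} (hh : ∀ i, h i ≤ C)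
    (hgh : ∀ i, g i ≤ h i + ε) (hg : BddBelow (Set.range g)) (j : ℕ) :
    sortDesc g j ≤ sortDesc h j + ε := by
  refine csSup_le ?_ ?_
  · obtain ⟨b, hb⟩ := hg
    exact ⟨b, Finset.range (j + 1), Finset.card_range _, fun i _ => hb ⟨i, rfl⟩⟩
  · rintro x ⟨s, hs, hx⟩
    rw [← sub_le_iff_le_add]
    refine le_csSup ⟨C, ?_⟩ ⟨s, hs, fun i hi => by linarith [hx i hi, hgh i]⟩
    rintro y ⟨t, ht, hy⟩
    obtain ⟨i, hi⟩ : t.Nonempty := Finset.card_pos.1 (by omega)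
    exact (hy i hi).trans (hh i)

lemma abs_sortDesc_sub_le {g h : ℕ → ℝ} {ε C : ℝ} (hg : ∀ i, g i ∈ Set.Icc 0 C)
    (hh : ∀ i, h i ∈ Set.Icc 0 C) (hgh : ∀ i, |g i - h i| ≤ ε) (j : ℕ) :
    |sortDesc g j - sortDesc h j| ≤ ε := by
  have b : ∀ {f : ℕ → ℝ}, (∀ i, f i ∈ Set.Icc 0 C) → BddBelow (Set.range f) := fun hf =>
    ⟨0, by rintro _ ⟨i, rfl⟩; exact (hf i).1⟩
  have h1 := sortDesc_le_add (fun i => (hh i).2)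
    (fun i => by linarith [(abs_le.1 (hgh i)).2]) (b hg) j
  have h2 := sortDesc_le_add (fun i => (hg i).2)
    (fun i => by linarith [(abs_le.1 (hgh i)).1]) (b hh) j
  rw [abs_le]
  constructor <;> linarith

/-- Up to index `M` the rounding error is at most `(M + 1) / n`; after `M` both sequences lie
between `0` and the product of the first `M` factors. -/
lemma tendsto_sortDesc_discreteSticks {u : ℕ → ℝ} (hu : ∀ i, u i ∈ Set.Icc 0 1)
    (hlim : Tendsto (fun M => ∏ m ∈ Finset.range M, u m) atTop (𝓝 0)) (j : ℕ) :
    Tendsto (fun n : ℕ => sortDesc (fun i => ((discreteSticks n u).getD i 0 : ℝ) / n) j) atTop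
      (𝓝 (sortDesc (stickBreaking u) j)) := by
  rw [Metric.tendsto_atTop]
  intro ε hε
  obtain ⟨M, hM⟩ := (hlim.eventually_lt_const (half_pos hε)).exists
  obtain ⟨N, hN⟩ := exists_nat_gt ((M + 1) / (ε / 2))
  refine ⟨N + 1, fun n hn => ?_⟩
  have hn0 : (0 : ℝ) < n := by exact_mod_cast (by omega : 0 < n)
  have hMn : (M + 1 : ℝ) / n ≤ ε / 2 := by
    have : (N : ℝ) ≤ n := by exact_mod_cast (by omega : N ≤ n)
    rw [div_lt_iff₀ (half_pos hε)] at hN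
    rw [div_le_iff₀ hn0]
    nlinarith
  have hle : ∀ i, ((discreteSticks n u).getD i 0 : ℝ) / n ≤ ∏ m ∈ Finset.range i, u m := by
    intro i
    rw [div_le_iff₀ hn0, mul_comm]
    exact getD_discreteSticks_le n hu i
  have hle1 : ∀ i, ∏ m ∈ Finset.range i, u m ≤ 1 := fun i => by
    simpa using prod_range_antitone hu (Nat.zero_le i)
  rw [Real.dist_eq]
  refine (abs_sortDesc_sub_le (C := 1) (ε := ε / 2)
    (fun i => ⟨by positivity, (hle i).trans (hle1 i)⟩)
    (fun i => ⟨stickBreaking_nonneg hu i, stickBreaking_le_one hu i⟩) (fun i => ?_) j).trans_lt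
    (half_lt_self hε)
  rcases le_total i M with hi | hi
  · have h1 := abs_getD_discreteSticks_sub_le n hu i
    have h2 : ((discreteSticks n u).getD i 0 : ℝ) / n - stickBreaking u i =
        (((discreteSticks n u).getD i 0 : ℝ) - n * stickBreaking u i) / n := by
      field_simp
    rw [h2, abs_div, abs_of_pos hn0]
    refine le_trans ?_ hMn
    gcongr
    refine h1.trans ?_
    gcongr
  · have h1 := prod_range_antitone hu hi
    have h2 := stickBreaking_le_prod hu i
    have h3 := stickBreaking_nonneg hu i
    have h4 : (0 : ℝ) ≤ ((discreteSticks n u).getD i 0 : ℝ) / n := by positivity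
    have h5 := hle i
    simp only at h1
    rw [abs_le]
    constructor <;> linarith

/-! ### The law of the discrete sticks -/

lemma measurable_discreteRemainder (n : ℕ) : Measurable (discreteRemainder n) :=
  (Nat.measurable_floor.comp (measurable_id.mul_const _)).min measurable_const

lemma measurableSet_discreteSticks_mem {Ω : Type*} [MeasurableSpace Ω] (n : ℕ) {U : ℕ → Ω → ℝ}
    (hU : ∀ i, Measurable (U i)) (S : Set (List ℕ)) :
    MeasurableSet {ω | discreteSticks n (fun i => U i ω) ∈ S} := by
  induction n using Nat.strong_induction_on generalizing U S with
  | _ n ih =>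
    cases n with
    | zero => simp [discreteSticks]
    | succ n =>
      have : {ω | discreteSticks (n + 1) (fun i => U i ω) ∈ S} =
          ⋃ m ∈ Finset.range (n + 1), {ω | discreteRemainder n (U 0 ω) = m} ∩
            {ω | discreteSticks m (fun i => U (i + 1) ω) ∈ {l | (n + 1 - m) :: l ∈ S}} := by
        ext ω
        have := discreteRemainder_le n (U 0 ω)
        simp [discreteSticks, this]
      rw [this]
      refine Finset.measurableSet_biUnion _ fun m hm => MeasurableSet.inter ?_ ?_
      · exact measurableSet_eq_fun ((measurable_discreteRemainder n).comp (hU 0)) measurable_const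
      · exact ih m (Finset.mem_range.1 hm) (fun i => hU (i + 1)) _

lemma volume_restrict_discreteRemainder_eq {n m : ℕ} (hm : m ≤ n) :
    (volume.restrict (Set.Icc (0 : ℝ) 1)) {u | discreteRemainder n u = m} =
      ENNReal.ofReal ((n + 1 : ℝ)⁻¹) := by
  have hn : (0 : ℝ) < n + 1 := by positivity
  have hmn : (m : ℝ) ≤ n := by exact_mod_cast hm
  -- On `[0,1]` the truncation by `n` acts only at the null point `u = 1`, which `Ico` discards.
  have hset : {u : ℝ | discreteRemainder n u = m} ∩ Set.Ico 0 1 =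
      Set.Ico ((m : ℝ) / (n + 1)) ((m + 1) / (n + 1)) := by
    ext u
    simp only [Set.mem_inter_iff, Set.mem_ofPred_eq, Set.mem_Ico, div_le_iff₀ hn, lt_div_iff₀ hn]
    have key : 0 ≤ u → u < 1 → discreteRemainder n u = ⌊u * (n + 1)⌋₊ := fun h0 h1 => by
      refine min_eq_left (Nat.le_of_lt_succ ((Nat.floor_lt (by positivity)).2 ?_))
      push_cast
      nlinarith
    constructor
    · rintro ⟨h, h0, h1⟩
      rw [key h0 h1] at h
      exact (Nat.floor_eq_iff (by positivity)).1 h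
    · rintro ⟨h0, h1⟩
      have hu0 : 0 ≤ u := by
        by_contra hc
        have : (0 : ℝ) ≤ m := Nat.cast_nonneg m
        nlinarith
      have hu1 : u < 1 := by
        by_contra hc
        nlinarith
      rw [key hu0 hu1]
      exact ⟨(Nat.floor_eq_iff (by positivity)).2 ⟨h0, h1⟩, hu0, hu1⟩
  rw [← restrict_Ico_eq_restrict_Icc, Measure.restrict_apply
    (measurableSet_eq_fun (measurable_discreteRemainder n) measurable_const), hset,
    Real.volume_Ico]
  congr 1
  field_simp
  ring

lemma measure_discreteRemainder_inter {Ω : Type*} [MeasurableSpace Ω] {P : Measure Ω}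
    [IsProbabilityMeasure P] {U : ℕ → Ω → ℝ} (hmeas : ∀ i, Measurable (U i))
    (hU : ∀ i, HasLaw (U i) (volume.restrict (Set.Icc (0 : ℝ) 1)) P)
    (hind : iIndepFun U P) {n m : ℕ} (hm : m ≤ n) (S : Set (List ℕ)) :
    P.real ({ω | discreteRemainder n (U 0 ω) = m} ∩
      {ω | discreteSticks m (fun i => U (i + 1) ω) ∈ S}) =
      (n + 1 : ℝ)⁻¹ * P.real {ω | discreteSticks m (fun i => U (i + 1) ω) ∈ S} := by
  have hi := indep_iSup_of_disjoint (fun i => (hmeas i).comap_le) hind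
    (S := {0}) (T := {0}ᶜ) disjoint_compl_right
  have h0 : MeasurableSet {u | discreteRemainder n u = m} :=
    measurableSet_eq_fun (measurable_discreteRemainder n) measurable_const
  have hprod := (Indep_iff _ _ P).1 hi {ω | discreteRemainder n (U 0 ω) = m}
    {ω | discreteSticks m (fun i => U (i + 1) ω) ∈ S} ?_ ?_
  · rw [measureReal_def, hprod, ENNReal.toReal_mul]
    congr 1
    have := (hU 0).map_eq ▸ Measure.map_apply_of_aemeasurable (hU 0).aemeasurable h0
    rw [volume_restrict_discreteRemainder_eq hm] at this
    rw [show {ω | discreteRemainder n (U 0 ω) = m} =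
      U 0 ⁻¹' {u | discreteRemainder n u = m} from rfl, ← this,
      ENNReal.toReal_ofReal (by positivity)]
  · exact le_iSup₂_of_le (f := fun i (_ : i ∈ ({0} : Set ℕ)) =>
      MeasurableSpace.comap (U i) inferInstance) 0 rfl le_rfl _ ⟨_, h0, rfl⟩
  -- Measurability is applied with the σ-algebra generated by the later variables in place of the
  -- ambient one.
  · refine @measurableSet_discreteSticks_mem Ω (_) m _ (fun i => ?_) S
    refine Measurable.mono (comap_measurable (U (i + 1))) ?_ le_rfl
    exact le_iSup₂_of_le (f := fun i (_ : i ∈ ({0}ᶜ : Set ℕ)) =>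
      MeasurableSpace.comap (U i) inferInstance) (i + 1) (by simp) le_rfl

/-- Strong induction, splitting over the first piece `c`: it has probability `1 / (n + 1)`, and by
independence the rest must realise `s.erase c`. -/
lemma measure_discreteSticks_eq {Ω : Type*} [MeasurableSpace Ω] {P : Measure Ω}
    [IsProbabilityMeasure P] {U : ℕ → Ω → ℝ} (hmeas : ∀ i, Measurable (U i))
    (hU : ∀ i, HasLaw (U i) (volume.restrict (Set.Icc (0 : ℝ) 1)) P)
    (hind : iIndepFun U P) (n : ℕ) {s : Multiset ℕ} (hs : 0 ∉ s) (hsum : s.sum = n) :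
    P.real {ω | (discreteSticks n (fun i => U i ω) : Multiset ℕ) = s} =
      (centralizerOrder s : ℝ)⁻¹ := by
  induction n using Nat.strong_induction_on generalizing U s with
  | _ n ih =>
    cases n with
    | zero =>
      have : s = 0 := by
        refine Multiset.eq_zero_of_forall_notMem fun a ha => hs ?_
        rwa [Multiset.sum_eq_zero_iff.1 hsum a ha] at ha
      subst this
      simp [discreteSticks, centralizerOrder]
    | succ n =>
      have hU' : ∀ i, HasLaw (U (i + 1)) (volume.restrict (Set.Icc (0 : ℝ) 1)) P :=
        fun i => hU (i + 1)
      have hind' : iIndepFun (fun i => U (i + 1)) P := hind.precomp (add_left_injective 1)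
      have hset : {ω | (discreteSticks (n + 1) (fun i => U i ω) : Multiset ℕ) = s} =
          ⋃ c ∈ s.toFinset, {ω | discreteRemainder n (U 0 ω) = n + 1 - c} ∩
            {ω | discreteSticks (n + 1 - c) (fun i => U (i + 1) ω) ∈
              {l : List ℕ | (l : Multiset ℕ) = s.erase c}} := by
        ext ω
        have hle := discreteRemainder_le n (U 0 ω)
        simp only [Set.mem_ofPred_eq, Set.mem_iUnion, Set.mem_inter_iff, Multiset.mem_toFinset,
          exists_prop]
        rw [discreteSticks, ← Multiset.cons_coe]
        constructor
        · intro h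
          refine ⟨n + 1 - discreteRemainder n (U 0 ω), ?_, by omega, ?_⟩
          · rw [← h]; exact Multiset.mem_cons_self _ _
          · rw [← h, Multiset.erase_cons_head, Nat.sub_sub_self (by omega)]
        · rintro ⟨c, hc, h1, h2⟩
          have : c ≤ n + 1 := hsum ▸ Multiset.le_sum_of_mem hc
          rw [h1, h2, Nat.sub_sub_self this, Multiset.cons_erase hc]
      have hcpos : ∀ c ∈ s.toFinset, 0 < c ∧ c ≤ n + 1 := fun c hc => by
        rw [Multiset.mem_toFinset] at hc
        exact ⟨Nat.pos_of_ne_zero fun h => hs (h ▸ hc), hsum ▸ Multiset.le_sum_of_mem hc⟩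
      rw [hset, measureReal_biUnion_finset]
      · have hterm : ∀ c ∈ s.toFinset, P.real ({ω | discreteRemainder n (U 0 ω) = n + 1 - c} ∩
            {ω | discreteSticks (n + 1 - c) (fun i => U (i + 1) ω) ∈
              {l : List ℕ | (l : Multiset ℕ) = s.erase c}}) =
            (n + 1 : ℝ)⁻¹ * (centralizerOrder (s.erase c) : ℝ)⁻¹ := by
          intro c hc
          have h1 := hcpos c hc
          have h2 := Multiset.sum_erase (Multiset.mem_toFinset.1 hc)
          rw [measure_discreteRemainder_inter hmeas hU hind (by omega)]
          congr 1
          exact ih _ (by omega) (fun i => hmeas (i + 1)) hU' hind'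
            (fun h => hs (Multiset.mem_of_mem_erase h)) (by omega)
        rw [Finset.sum_congr rfl hterm, ← Finset.mul_sum, sum_inv_centralizerOrder_erase hs, hsum]
        push_cast
        field_simp
      · intro c hc d hd hcd
        refine Set.disjoint_left.2 fun ω h1 h2 => hcd ?_
        have e1 : discreteRemainder n (U 0 ω) = n + 1 - c := h1.1
        have e2 : discreteRemainder n (U 0 ω) = n + 1 - d := h2.1
        have := hcpos c hc
        have := hcpos d hd
        omega
      · intro c _
        exact (measurableSet_eq_fun ((measurable_discreteRemainder n).comp (hmeas 0))
          measurable_const).inter (measurableSet_discreteSticks_mem _ (fun i => hmeas (i + 1)) _)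

/-! ### Almost sure decay of the products -/

lemma lintegral_ofReal_uniform {Ω : Type*} [MeasurableSpace Ω] {P : Measure Ω} {X : Ω → ℝ}
    (hX : HasLaw X (volume.restrict (Set.Icc (0 : ℝ) 1)) P) :
    ∫⁻ ω, ENNReal.ofReal (X ω) ∂P = 2⁻¹ := by
  have h1 : ∫⁻ ω, ENNReal.ofReal (X ω) ∂P =
      ∫⁻ x in Set.Icc (0 : ℝ) 1, ENNReal.ofReal x := by
    rw [← hX.map_eq, lintegral_map' ENNReal.measurable_ofReal.aemeasurable hX.aemeasurable]
  have hint : IntegrableOn (fun x : ℝ => x) (Set.Icc 0 1) :=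
    continuous_id.continuousOn.integrableOn_Icc
  rw [h1, ← ofReal_integral_eq_lintegral_ofReal hint
    ((ae_restrict_mem measurableSet_Icc).mono fun x hx => hx.1), integral_Icc_eq_integral_Ioc,
    ← intervalIntegral.integral_of_le zero_le_one, integral_id]
  norm_num
  rw [ENNReal.ofReal_div_of_pos two_pos]
  norm_num

lemma ae_mem_Icc_of_hasLaw {Ω : Type*} [MeasurableSpace Ω] {P : Measure Ω} {U : ℕ → Ω → ℝ}
    (hU : ∀ i, HasLaw (U i) (volume.restrict (Set.Icc (0 : ℝ) 1)) P) :
    ∀ᵐ ω ∂P, ∀ i, U i ω ∈ Set.Icc (0 : ℝ) 1 := by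
  refine ae_all_iff.2 fun i => ?_
  refine ae_of_ae_map (p := (· ∈ Set.Icc (0 : ℝ) 1)) (hU i).aemeasurable ?_
  rw [(hU i).map_eq]
  exact ae_restrict_mem measurableSet_Icc

/-- The products have expectations `2⁻¹ ^ M`, which are summable, so their series is almost surely
finite and its terms tend to `0`. -/
lemma ae_tendsto_prod_uniform {Ω : Type*} [MeasurableSpace Ω] {P : Measure Ω}
    {U : ℕ → Ω → ℝ} (hmeas : ∀ i, Measurable (U i))
    (hU : ∀ i, HasLaw (U i) (volume.restrict (Set.Icc (0 : ℝ) 1)) P)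
    (hind : iIndepFun U P) :
    ∀ᵐ ω ∂P, Tendsto (fun M => ∏ m ∈ Finset.range M, U m ω) atTop (𝓝 0) := by
  have hm : ∀ i, Measurable fun ω => ENNReal.ofReal (U i ω) := fun i => (hmeas i).ennreal_ofReal
  have hm' : ∀ M, Measurable fun ω => ∏ m ∈ Finset.range M, ENNReal.ofReal (U m ω) :=
    fun M => Finset.measurable_fun_prod _ fun i _ => hm i
  have hfin : ∫⁻ ω, ∑' M, ∏ m ∈ Finset.range M, ENNReal.ofReal (U m ω) ∂P ≠ ⊤ := by
    rw [lintegral_tsum fun M => (hm' M).aemeasurable]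
    have : ∀ M, ∫⁻ ω, ∏ m ∈ Finset.range M, ENNReal.ofReal (U m ω) ∂P = 2⁻¹ ^ M := fun M => by
      rw [lintegral_prod_eq_prod_lintegral_of_indepFun _ (fun i ω => ENNReal.ofReal (U i ω))
        (hind.comp (fun _ => ENNReal.ofReal) fun _ => ENNReal.measurable_ofReal) hm]
      simp [lintegral_ofReal_uniform (hU _)]
    simp only [this]
    rw [ENNReal.tsum_geometric]
    simp
  filter_upwards [ae_lt_top (Measurable.tsum hm') hfin, ae_mem_Icc_of_hasLaw hU]
    with ω hω hω'
  have h := (ENNReal.continuousAt_toReal ENNReal.zero_ne_top).tendsto.comp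
    (ENNReal.tendsto_atTop_zero_of_tsum_ne_top hω.ne)
  refine h.congr fun M => ?_
  simp only [Function.comp_apply, ENNReal.toReal_prod]
  exact Finset.prod_congr rfl fun i _ => ENNReal.toReal_ofReal (hω' i).1

/-! ### Equality in law and the conclusion -/

lemma measureReal_uniformOn_partition_parts_eq (n : ℕ) {s : Multiset ℕ} (h : 0 ∉ s)
    (hs : s.sum = n) :
    (uniformOn (Set.univ : Set (Equiv.Perm (Fin n)))).real {σ | σ.partition.parts = s} =
      (centralizerOrder s : ℝ)⁻¹ := by
  have hz : (centralizerOrder s : ℝ) ≠ 0 := by exact_mod_cast (centralizerOrder_pos h).ne'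
  have key := congrArg (Nat.cast (R := ℝ)) (card_perm_partition_parts_mul n h hs)
  push_cast at key
  have hset : {σ : Equiv.Perm (Fin n) | σ.partition.parts = s} =
      ((Finset.univ.filter fun σ : Equiv.Perm (Fin n) => σ.partition.parts = s :
        Finset (Equiv.Perm (Fin n))) : Set (Equiv.Perm (Fin n))) := by
    ext; simp
  have hcard : Fintype.card (Equiv.Perm (Fin n)) = n.factorial := by
    rw [Fintype.card_perm, Fintype.card_fin]
  rw [measureReal_def, uniformOn_univ, hset,
    Measure.count_apply_finset' (MeasurableSpace.measurableSet_top), hcard, ENNReal.toReal_div, ENNReal.toReal_natCast, ENNReal.toReal_natCast]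
  have hn : (n.factorial : ℝ) ≠ 0 := by positivity
  field_simp
  exact key

/-- The normalised parts of a multiset of natural numbers in non-increasing order. -/
noncomputable def sortedParts (n k : ℕ) (s : Multiset ℕ) (j : Fin k) : ℝ :=
  ((s.sort (· ≥ ·)).getD j 0 : ℝ) / n

/-- Both sides push forward laws on the countable space `Multiset ℕ`, so agreement on singletons
suffices; multisets that are not partitions of `n` have empty preimages. -/
lemma map_sortedParts_discreteSticks {Ω Ω' : Type*} [MeasurableSpace Ω] [MeasurableSpace Ω']
    {P : Measure Ω} {P' : Measure Ω'} [IsProbabilityMeasure P] [IsProbabilityMeasure P'] {n : ℕ}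
    {π : Ω → Equiv.Perm (Fin n)} (hπ : HasLaw π (uniformOn Set.univ) P)
    {U : ℕ → Ω' → ℝ} (hmeas : ∀ i, Measurable (U i))
    (hU : ∀ i, HasLaw (U i) (volume.restrict (Set.Icc (0 : ℝ) 1)) P')
    (hind : iIndepFun U P') (k : ℕ) :
    P.map (fun ω => sortedParts n k (π ω).partition.parts) =
      P'.map (fun ω => sortedParts n k (discreteSticks n fun i => U i ω)) := by
  let _ : MeasurableSpace (Multiset ℕ) := ⊤
  have hF : Measurable (sortedParts n k) := measurable_from_top
  have hparts : Measurable fun σ : Equiv.Perm (Fin n) => σ.partition.parts := measurable_from_top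
  have hX : AEMeasurable (fun ω => (π ω).partition.parts) P :=
    hparts.comp_aemeasurable hπ.aemeasurable
  have hY : Measurable fun ω => (discreteSticks n (fun i => U i ω) : Multiset ℕ) := fun S _ =>
    measurableSet_discreteSticks_mem n hmeas {l | (l : Multiset ℕ) ∈ S}
  have hmain : P.map (fun ω => (π ω).partition.parts) =
      P'.map (fun ω => (discreteSticks n (fun i => U i ω) : Multiset ℕ)) := by
    have := Measure.isProbabilityMeasure_map (μ := P) hX
    have := Measure.isProbabilityMeasure_map (μ := P') hY.aemeasurable
    refine Measure.ext_of_singleton fun s => ?_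
    rw [Measure.map_apply_of_aemeasurable hX MeasurableSpace.measurableSet_top,
      Measure.map_apply hY MeasurableSpace.measurableSet_top]
    by_cases hs : 0 ∉ s ∧ s.sum = n
    · have h1 := measure_discreteSticks_eq hmeas hU hind n hs.1 hs.2
      have h2 := measureReal_uniformOn_partition_parts_eq n hs.1 hs.2
      rw [← hπ.map_eq, measureReal_def, Measure.map_apply_of_aemeasurable hπ.aemeasurable
        MeasurableSpace.measurableSet_top] at h2
      refine (ENNReal.toReal_eq_toReal_iff' (measure_ne_top _ _) (measure_ne_top _ _)).1 ?_
      exact h2.trans h1.symm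
    · have h1 : (fun ω => (π ω).partition.parts) ⁻¹' {s} = ∅ := by
        refine Set.eq_empty_of_forall_notMem fun ω hω => hs ?_
        rw [← show (π ω).partition.parts = s from hω]
        refine ⟨fun h => ((π ω).partition.parts_pos h).ne' rfl, ?_⟩
        rw [(π ω).partition.parts_sum, Fintype.card_fin]
      have h2 : (fun ω => (discreteSticks n (fun i => U i ω) : Multiset ℕ)) ⁻¹' {s} = ∅ := by
        refine Set.eq_empty_of_forall_notMem fun ω hω => hs ?_
        rw [← show (discreteSticks n (fun i => U i ω) : Multiset ℕ) = s from hω]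
        exact ⟨zero_notMem_discreteSticks n _, by
          rw [Multiset.sum_coe, sum_discreteSticks]⟩
      rw [h1, h2, measure_empty, measure_empty]
  have e1 := AEMeasurable.map_map_of_aemeasurable (μ := P) hF.aemeasurable hX
  have e2 := AEMeasurable.map_map_of_aemeasurable (μ := P') hF.aemeasurable hY.aemeasurable
  rw [hmain] at e1
  exact e1.symm.trans e2

theorem mainTheorem5
    -- for every `n`, a uniform random permutation `π n` of length `n`
    {Ω : ℕ → Type*} [∀ n, MeasurableSpace (Ω n)]
    (P : ∀ n, MeasureTheory.Measure (Ω n)) [∀ n, MeasureTheory.IsProbabilityMeasure (P n)]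
    (π : ∀ n, Ω n → Equiv.Perm (Fin n))
    (hπ : ∀ n, ProbabilityTheory.HasLaw (π n) (ProbabilityTheory.uniformOn Set.univ) (P n))
    -- independent random variables `U i`, uniform on `[0,1]`
    {Ω' : Type*} [MeasurableSpace Ω']
    (P' : MeasureTheory.Measure Ω') [MeasureTheory.IsProbabilityMeasure P']
    (U : ℕ → Ω' → ℝ)
    (hU : ∀ i, ProbabilityTheory.HasLaw (U i)
      (MeasureTheory.volume.restrict (Set.Icc (0 : ℝ) 1)) P')
    (hind : ProbabilityTheory.iIndepFun U P')
    (k : ℕ) :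
    MeasureTheory.TendstoInDistribution
      (fun (n : ℕ) (ω : Ω n) (j : Fin k) => (cycleLength (π n ω) j : ℝ) / (n : ℝ))
      Filter.atTop
      (fun (ω : Ω') (j : Fin k) => poissonDirichlet U j ω)
      P P' := by
  -- `HasLaw` gives only a.e. measurability; measurable versions keep the laws and the independence.
  set V : ℕ → Ω' → ℝ := fun i => (hU i).aemeasurable.mk with hV
  have hUV : ∀ i, U i =ᵐ[P'] V i := fun i => (hU i).aemeasurable.ae_eq_mk
  have hVmeas : ∀ i, Measurable (V i) := fun i => (hU i).aemeasurable.measurable_mk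
  have hVlaw : ∀ i, HasLaw (V i) (volume.restrict (Set.Icc (0 : ℝ) 1)) P' := fun i =>
    ⟨(hVmeas i).aemeasurable, by rw [← (hU i).map_eq, Measure.map_congr (hUV i)]⟩
  have hVind : iIndepFun V P' := hind.congr hUV
  have hperm : ∀ n, AEMeasurable
      (fun ω (j : Fin k) => (cycleLength (π n ω) j : ℝ) / (n : ℝ)) (P n) := fun n =>
    (measurable_from_top (f := fun σ : Equiv.Perm (Fin n) => fun j : Fin k =>
      (cycleLength σ j : ℝ) / (n : ℝ))).comp_aemeasurable (hπ n).aemeasurable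
  have hsticks : ∀ n, Measurable
      (fun ω => sortedParts n k (discreteSticks n fun i => V i ω)) := fun n S _ =>
    measurableSet_discreteSticks_mem n hVmeas {l | sortedParts n k l ∈ S}
  have hconv : ∀ᵐ ω ∂P', Tendsto
      (fun n => sortedParts n k (discreteSticks n fun i => V i ω)) atTop
      (𝓝 fun j : Fin k => poissonDirichlet U j ω) := by
    filter_upwards [ae_all_iff.2 hUV, ae_mem_Icc_of_hasLaw hVlaw,
      ae_tendsto_prod_uniform hVmeas hVlaw hVind] with ω h1 h2 h3
    refine tendsto_pi_nhds.2 fun j => ?_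
    have := tendsto_sortDesc_discreteSticks h2 h3 j
    simp only [sortDesc_getD_div] at this
    simpa only [poissonDirichlet, h1, sortedParts] using this
  have hdist := (tendstoInMeasure_of_tendsto_ae
    (fun n => (hsticks n).aestronglyMeasurable) hconv).tendstoInDistribution
    fun n => (hsticks n).aemeasurable
  refine ⟨hperm, hdist.aemeasurable_limit, ?_⟩
  exact hdist.tendsto.congr fun n =>
    Subtype.ext (map_sortedParts_discreteSticks (hπ n) hVmeas hVlaw hVind k).symm
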